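/- All graphs are finite, undirected and without parallel edges; loops are allowed. A homomorphism $G\to H$ is a map $V(G)\to V(H)$ that sends edges to edges. A graph $H$ is a *core* if it has no homomorphism to any of its proper subgraphs. For a fixed graph $H$, $\mathrm{Hom}(H)$ is the problem of deciding whether a given graph $G$ has a homomorphism to $H$. A *path decomposition* of $G$ is a sequence of sets $X_1,\dots,X_\ell\subseteq V(G)$ (bags), $\ell\ge 1$, such that every vertex lies in some bag, the two ends of every edge lie in a common bag, and for every vertex $v$ the indices $a$ with $v\in X_a$ are consecutive; its width is $\max_a|X_a|-1$, the pathwidth $\mathrm{pw}(G)$ is the minimum width of a path decomposition of $G$, and a path decomposition of that width is *optimal*. We say that $\mathrm{Hom}(H)$ can be solved in time $\mathcal O^*(\alpha^{\mathrm{pw}(G)})$ if there are an algorithm and constants $c,d$ such that, on every input consisting of a graph $G$ along with an optimal path decomposition of $G$, of total size $N$, the algorithm decides correctly whether $G\to H$ in at most $c\cdot\alpha^{\mathrm{pw}(G)}\cdot N^d$ steps. **Lemma.** Let $H=H_1+\dots+H_m$ be a fixed disconnected core with connected components $H_1,\dots,H_m$ ($m\ge 2$), and let $\alpha\ge 1$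 be a real number. Assume that $\mathrm{Hom}(H)$ can be solved in time $\mathcal O^*(\alpha^{\mathrm{pw}(G)})$. Then for every $i\in\{1,\dots,m\}$, $\mathrm{Hom}(H_i)$ can be solved in time $\mathcal O^*(\alpha^{\mathrm{pw}(G)})$. -/

import Mathlib

/-! ### Graphs, homomorphisms, cores, connected components -/

/-- An undirected graph without parallel edges; loops are allowed. -/
structure LGraph (V : Type*) where
  Adj : V → V → Prop
  symm : ∀ u v, Adj u v → Adj v u

namespace LGraph

/-- `G.HomTo H` is the relation `G → H`: some map of the vertices preserves all edges. -/
def HomTo {V W : Type*} (G : LGraph V) (H : LGraph W) : Prop :=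
  Nonempty (G.Adj →r H.Adj)

/-- A subgraph: a set of vertices and a set of edges of `G` between these vertices. -/
structure Subgraph {V : Type*} (G : LGraph V) where
  verts : Set V
  Adj : V → V → Prop
  symm : ∀ u v, Adj u v → Adj v u
  adj_sub : ∀ u v, Adj u v → G.Adj u v
  mem_verts : ∀ u v, Adj u v → u ∈ verts

/-- A subgraph as a graph on its own vertex set. -/
def Subgraph.coe {V : Type*} {G : LGraph V} (K : G.Subgraph) : LGraph K.verts where
  Adj u v := K.Adj u v
  symm u v h := K.symm u v h

/-- A subgraph is proper if it misses a vertex or an edge of `G`. -/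
def Subgraph.IsProper {V : Type*} {G : LGraph V} (K : G.Subgraph) : Prop :=
  (∃ v, v ∉ K.verts) ∨ ∃ u v, G.Adj u v ∧ ¬ K.Adj u v

/-- A core has no homomorphism to any of its proper subgraphs. -/
def IsCore {V : Type*} (G : LGraph V) : Prop :=
  ∀ K : G.Subgraph, K.IsProper → ¬ G.HomTo K.coe

/-- Two vertices are joined by a walk (possibly of length zero). -/
def Reachable {V : Type*} (G : LGraph V) : V → V → Prop :=
  Relation.ReflTransGen G.Adj

/-- `G` has at least two connected components. -/
def IsDisconnected {V : Type*} (G : LGraph V) : Prop :=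
  ∃ u v, ¬ G.Reachable u v

/-- The connected component of `G` that contains `v`, as a graph on its own vertex set. -/
def component {V : Type*} (G : LGraph V) (v : V) : LGraph {w : V // G.Reachable v w} where
  Adj x y := G.Adj x y
  symm x y h := G.symm x y h

/-! ### Path decompositions and pathwidth -/

/-- The list `B` of bags, read along a path, is a path decomposition of `G`. -/
structure IsPathDecomposition {V : Type*} (G : LGraph V) (B : List (Finset V)) : Prop where
  nonempty : B ≠ []
  vertex : ∀ v, ∃ X ∈ B, v ∈ X
  edge : ∀ u v, G.Adj u v → ∃ X ∈ B, u ∈ X ∧ v ∈ X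
  interval : ∀ (i j k : Fin B.length) (v : V), i ≤ j → j ≤ k → v ∈ B[i] → v ∈ B[k] → v ∈ B[j]

/-- The largest size of a bag. -/
def maxBag {V : Type*} (B : List (Finset V)) : ℕ :=
  (B.map Finset.card).foldr max 0

/-- The width of a path decomposition: the largest size of a bag, minus one. (The graph without
vertices gets width `0` here, instead of `-1`.) -/
def width {V : Type*} (B : List (Finset V)) : ℕ :=
  maxBag B - 1

/-- The minimum width of a path decomposition of `G`. -/
noncomputable def pathwidth {V : Type*} (G : LGraph V) : ℕ :=
  sInf {w | ∃ B : List (Finset V), G.IsPathDecomposition B ∧ width B = w}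

end LGraph

/-! ### The model of computation

Programs of the WHILE language over binary trees. A value is a pointer to an immutable tree whose
subtrees may be shared; every elementary operation (copying a pointer, taking the left or right
child, allocating one new node, testing for the empty tree) costs one unit of time. This is a
pointer machine, and it agrees with the random access machine with logarithmic cost up to factors
that are polylogarithmic in the running time. -/

/-- Binary trees, the data on which programs work. -/
inductive TreeData where
  | nil : TreeData
  | cons : TreeData → TreeData → TreeData

namespace TreeData

/-- The number of nodes, leaves included. -/
def size : TreeData → ℕ
  | nil => 1
  | cons a b => a.size + b.size + 1

def hd : TreeData → TreeData
  | nil => nil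
  | cons a _ => a

def tl : TreeData → TreeData
  | nil => nil
  | cons _ b => b

/-- Natural numbers in unary. -/
def ofNat : ℕ → TreeData
  | 0 => nil
  | n + 1 => cons nil (ofNat n)

/-- Lists, given an encoding of the entries. -/
def ofList {A : Type*} (enc : A → TreeData) : List A → TreeData
  | [] => nil
  | a :: l => cons (enc a) (ofList enc l)

end TreeData

/-- Programs. Each one reads one tree and, if it halts, returns one tree. -/
inductive TreeProg where
  | id : TreeProg
  | nil : TreeProg
  | hd : TreeProg
  | tl : TreeProg
  | pair : TreeProg → TreeProg → TreeProg
  | seq : TreeProg → TreeProg → TreeProg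
  | ifElse : TreeProg → TreeProg → TreeProg → TreeProg
  | loop : TreeProg → TreeProg → TreeProg

/-- `Run p x y t`: on input `x`, the program `p` halts with output `y` after exactly `t` steps.
`seq p q` runs `p` and then `q` on the result; `pair p q` runs both on the same input and allocates
a node with the two results as children; `ifElse c p q` branches on whether the value of `c` is not
`nil`; `loop c p` replaces the current value by its image under `p` while `c` of it is not
`nil`. -/
inductive TreeProg.Run : TreeProg → TreeData → TreeData → ℕ → Prop where
  | id (x : TreeData) : Run .id x x 1
  | nil (x : TreeData) : Run .nil x .nil 1
  | hd (x : TreeData) : Run .hd x x.hd 1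
  | tl (x : TreeData) : Run .tl x x.tl 1
  | pair {p q : TreeProg} {x y z : TreeData} {s t : ℕ} :
      Run p x y s → Run q x z t → Run (.pair p q) x (.cons y z) (s + t + 1)
  | seq {p q : TreeProg} {x y z : TreeData} {s t : ℕ} :
      Run p x y s → Run q y z t → Run (.seq p q) x z (s + t + 1)
  | ifTrue {c p q : TreeProg} {x b y : TreeData} {s t : ℕ} :
      Run c x b s → b ≠ .nil → Run p x y t → Run (.ifElse c p q) x y (s + t + 1)
  | ifFalse {c p q : TreeProg} {x y : TreeData} {s t : ℕ} :
      Run c x .nil s → Run q x y t → Run (.ifElse c p q) x y (s + t + 1)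
  | loopStop {c p : TreeProg} {x : TreeData} {s : ℕ} :
      Run c x .nil s → Run (.loop c p) x x (s + 1)
  | loopStep {c p : TreeProg} {x b y z : TreeData} {s t r : ℕ} :
      Run c x b s → b ≠ .nil → Run p x y t → Run (.loop c p) y z r →
      Run (.loop c p) x z (s + t + r + 1)

/-! ### The problem -/

/-- What is written on the input: a number of vertices, a list of edges (in any order and
orientation, loops allowed) on the vertices `0, …, n - 1`, and a list of bags, each of them a list
of vertices. -/
structure HomInput where
  n : ℕ
  edges : List (Fin n × Fin n)
  bags : List (List (Fin n))

namespace HomInput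

/-- The instance graph. -/
def graph (I : HomInput) : LGraph (Fin I.n) where
  Adj u v := (u, v) ∈ I.edges ∨ (v, u) ∈ I.edges
  symm _ _ h := h.symm

/-- The bags, as sets of vertices. -/
def bagSets (I : HomInput) : List (Finset (Fin I.n)) :=
  I.bags.map List.toFinset

/-- The bags form a path decomposition of the instance graph of the minimum possible width. -/
def IsOptimal (I : HomInput) : Prop :=
  I.graph.IsPathDecomposition I.bagSets ∧ LGraph.width I.bagSets = I.graph.pathwidth

def encode (I : HomInput) : TreeData :=
  .cons (.ofNat I.n) (.cons
    (.ofList (fun e : Fin I.n × Fin I.n => .cons (.ofNat e.1) (.ofNat e.2)) I.edges)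
    (.ofList (.ofList fun v : Fin I.n => .ofNat v) I.bags))

end HomInput

/-- The problem Hom(`H`), for an instance graph `G` given along with an optimal path decomposition,
can be solved in time `O*(α ^ pw(G))`, where factors polynomial in the input size are
suppressed: one program, with constants `c` and `d`, halts on every such input within
`c * α ^ pw(G) * size ^ d` steps, and its output is not `nil` if and only if `G → H`. -/
def HomSolvableInTime {V : Type*} (H : LGraph V) (α : ℝ) : Prop :=
  ∃ (p : TreeProg) (c d : ℕ), ∀ I : HomInput, I.IsOptimal →
    ∃ (y : TreeData) (t : ℕ), p.Run I.encode y t ∧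
      (t : ℝ) ≤ c * α ^ I.graph.pathwidth * (I.encode.size : ℝ) ^ d ∧
      (y ≠ .nil ↔ I.graph.HomTo H)

open Polynomial

/-! ### Functions computed in polynomial time -/

/-! Fix a component `T` of `H` with `h` vertices. For a vertex `v` of the instance `G` and a vertex
`u` of `T`, let `G(v,u)` be `G` plus a copy of `T`, the edge `vu`, and a disjoint complete bipartite
graph `K_{N,N}`, where `N` is `h` plus the largest bag size. Then `G → T` if and only if for every
`v` some `u` gives `G(v,u) → H` (`homTo_component_iff`). In a core, `T` has no homomorphism into the
other components (`IsCore.reachable_apply`), so the copy of `T` lands in `T` and drags the component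
of `v` along; the homomorphisms for different `v` are glued over the components of `G`. Conversely,
a homomorphism `G → T` extends by the identity on the copy, with `u` a neighbour of the image of
`v`, and by sending `K_{N,N}` to one edge; `IsCore.exists_adj` provides these neighbours.

The algorithm for `H` is only guaranteed to work on optimal decompositions, and attaching `T` may
change the pathwidth in an unknown way. The bipartite graph settles this: its minimum degree forces
width `N`, and an explicit decomposition attains it (`pathwidth_extend`). As `N ≤ pw(G) + h + 1`,
the time grows by a constant factor `α ^ (h + 1)` and polynomial factors, the latter for
constructing `G(v,u)` (`polyTime_extendTree`) and for `n * h` calls. -/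

theorem Polynomial.eval_nat_mono (P : ℕ[X]) {m n : ℕ} (h : m ≤ n) : P.eval m ≤ P.eval n := by
  simp only [Polynomial.eval_eq_sum_range]
  gcongr

/-- Turns a polynomial bound into the form `c * size ^ d` that the definition of solvability asks
for. -/
theorem Polynomial.eval_nat_le (P : ℕ[X]) {s : ℕ} (hs : 1 ≤ s) :
    P.eval s ≤ P.eval 1 * s ^ P.natDegree := by
  simp only [Polynomial.eval_eq_sum_range, Finset.sum_mul, one_pow, mul_one]
  gcongr with i hi
  simpa [Nat.lt_succ_iff] using hi

namespace TreeData

theorem one_le_size (x : TreeData) : 1 ≤ x.size := by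
  cases x <;> simp [size]

theorem size_hd_le (x : TreeData) : x.hd.size ≤ x.size := by
  cases x <;> simp [size, hd]; omega

theorem size_tl_le (x : TreeData) : x.tl.size ≤ x.size := by
  cases x <;> simp [size, tl]; omega

@[simp] theorem hd_cons (a b : TreeData) : (cons a b).hd = a := rfl

@[simp] theorem tl_cons (a b : TreeData) : (cons a b).tl = b := rfl

/-- Branching on whether a tree is empty. -/
def cond (c a b : TreeData) : TreeData :=
  match c with
  | nil => b
  | cons _ _ => a

/-- A left fold over the right spine of a tree. The step function sees the context, the remaining
list and the accumulator. -/
def fold (g : TreeData → TreeData) (c : TreeData) : TreeData → TreeData → TreeData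
  | nil, acc => acc
  | cons a l, acc => fold g c l (g (cons c (cons (cons a l) acc)))

/-- A step function that adds a polynomial amount to the accumulator, independently of the size of
the accumulator. -/
def AdditiveGrowth (g : TreeData → TreeData) : Prop :=
  ∃ Q : ℕ[X], ∀ c l acc, (g (cons c (cons l acc))).size ≤ acc.size + Q.eval (c.size + l.size)

/-- Functions computed by a program in polynomial time, with outputs of polynomial size. -/
def PolyTime (f : TreeData → TreeData) : Prop :=
  ∃ (p : TreeProg) (P : ℕ[X]), ∀ x, (f x).size ≤ P.eval x.size ∧
    ∃ t ≤ P.eval x.size, p.Run x (f x) t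

/-- Iterating an arbitrary polynomial-time step could double the accumulator every round. Additive
growth sums to a polynomial over the list. -/
theorem size_fold_le {g : TreeData → TreeData} {Q : ℕ[X]}
    (hQ : ∀ c l acc, (g (cons c (cons l acc))).size ≤ acc.size + Q.eval (c.size + l.size))
    (c l acc : TreeData) :
    (fold g c l acc).size ≤ acc.size + l.size * Q.eval (c.size + l.size) := by
  induction l generalizing acc with
  | nil => simp [fold]
  | cons a l _ ih =>
    have h1 := ih (g (cons c (cons (cons a l) acc)))
    have h2 := hQ c (cons a l) acc
    have h3 : Q.eval (c.size + l.size) ≤ Q.eval (c.size + (cons a l).size) :=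
      Q.eval_nat_mono (by simp [size]; omega)
    have h4 : l.size * Q.eval (c.size + l.size) ≤ l.size * Q.eval (c.size + (cons a l).size) :=
      Nat.mul_le_mul_left _ h3
    have h5 : (l.size + 1) * Q.eval (c.size + (cons a l).size)
        ≤ (cons a l).size * Q.eval (c.size + (cons a l).size) :=
      Nat.mul_le_mul_right _ (by simp [size])
    rw [add_mul, one_mul] at h5
    simp only [fold]
    omega

namespace PolyTime

theorem id : PolyTime fun x => x :=
  ⟨.id, X + 1, fun x => ⟨by simp, 1, by simp, .id x⟩⟩

theorem nil : PolyTime fun _ => .nil :=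
  ⟨.nil, 1, fun x => ⟨by simp [size], 1, by simp, .nil x⟩⟩

theorem comp {f g : TreeData → TreeData} (hg : PolyTime g) (hf : PolyTime f) :
    PolyTime fun x => g (f x) := by
  obtain ⟨p, P, hp⟩ := hf
  obtain ⟨q, Q, hq⟩ := hg
  refine ⟨.seq p q, P + Q.comp P + 1, fun x => ?_⟩
  obtain ⟨h1, t, ht, hr⟩ := hp x
  obtain ⟨h2, s, hs, hr'⟩ := hq (f x)
  have h3 := Q.eval_nat_mono h1
  simp only [eval_add, eval_comp, eval_one]
  exact ⟨by omega, _, by omega, .seq hr hr'⟩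

theorem hd {f : TreeData → TreeData} (hf : PolyTime f) : PolyTime fun x => (f x).hd :=
  comp ⟨.hd, X + 1, fun x => ⟨by simpa using (size_hd_le x).trans (Nat.le_succ _), 1, by simp,
    .hd x⟩⟩ hf

theorem tl {f : TreeData → TreeData} (hf : PolyTime f) : PolyTime fun x => (f x).tl :=
  comp ⟨.tl, X + 1, fun x => ⟨by simpa using (size_tl_le x).trans (Nat.le_succ _), 1, by simp,
    .tl x⟩⟩ hf

theorem cons {f g : TreeData → TreeData} (hf : PolyTime f) (hg : PolyTime g) :
    PolyTime fun x => .cons (f x) (g x) := by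
  obtain ⟨p, P, hp⟩ := hf
  obtain ⟨q, Q, hq⟩ := hg
  refine ⟨.pair p q, P + Q + 1, fun x => ?_⟩
  obtain ⟨h1, t, ht, hr⟩ := hp x
  obtain ⟨h2, s, hs, hr'⟩ := hq x
  simp only [eval_add, eval_one, size]
  exact ⟨by omega, _, by omega, .pair hr hr'⟩

theorem const (c : TreeData) : PolyTime fun _ => c := by
  induction c with
  | nil => exact nil
  | cons a b ha hb => exact cons ha hb

theorem cond {c f g : TreeData → TreeData} (hc : PolyTime c) (hf : PolyTime f)
    (hg : PolyTime g) : PolyTime fun x => (c x).cond (f x) (g x) := by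
  obtain ⟨r, R, hr⟩ := hc
  obtain ⟨p, P, hp⟩ := hf
  obtain ⟨q, Q, hq⟩ := hg
  refine ⟨.ifElse r p q, R + P + Q + 1, fun x => ?_⟩
  obtain ⟨-, t₀, ht₀, hr₀⟩ := hr x
  obtain ⟨h1, t₁, ht₁, hr₁⟩ := hp x
  obtain ⟨h2, t₂, ht₂, hr₂⟩ := hq x
  simp only [eval_add, eval_one]
  cases h : c x with
  | nil =>
    rw [h] at hr₀
    exact ⟨by simp only [TreeData.cond]; omega, _, by omega, .ifFalse hr₀ hr₂⟩
  | cons a b =>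
    rw [h] at hr₀
    exact ⟨by simp only [TreeData.cond]; omega, _, by omega, .ifTrue hr₀ (by simp) hr₁⟩

/-- The body of the loop that performs a fold. -/
def foldBody (p : TreeProg) : TreeProg :=
  .pair .hd (.pair (.seq .tl (.seq .hd .tl)) p)

/-- `S` and `M` bound the states of all rounds at once, which gives a uniform cost per round. The
quantity `acc.size + l.size * Q.eval S` does not increase, since a round that enlarges `acc` by at
most `Q.eval S` also shortens `l`. -/
theorem run_loop_foldBody {g : TreeData → TreeData} {p : TreeProg} {P Q : ℕ[X]}
    (hp : ∀ x, ∃ t ≤ P.eval x.size, p.Run x (g x) t)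
    (hQ : ∀ c l acc,
      (g (.cons c (.cons l acc))).size ≤ acc.size + Q.eval (c.size + l.size))
    (c : TreeData) (S M : ℕ) (l acc : TreeData) (hS : c.size + l.size ≤ S)
    (hM : acc.size + l.size * Q.eval S ≤ M) :
    ∃ t ≤ l.size * (P.eval (S + M + 2) + 20),
      (TreeProg.loop (.seq .tl .hd) (foldBody p)).Run (.cons c (.cons l acc))
        (.cons c (.cons .nil (fold g c l acc))) t := by
  induction l generalizing acc with
  | nil =>
    exact ⟨_, by simp [size], .loopStop (.seq (.tl _) (.hd _))⟩
  | cons a l _ ih =>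
    have e1 : (TreeData.cons a l).size = a.size + l.size + 1 := rfl
    have h2 := hQ c (.cons a l) acc
    have h3 := Q.eval_nat_mono hS
    have h5 : (l.size + 1) * Q.eval S ≤ (TreeData.cons a l).size * Q.eval S :=
      Nat.mul_le_mul_right _ (by simp [size])
    rw [add_mul, one_mul] at h5
    obtain ⟨t, ht, hr⟩ := ih (g (.cons c (.cons (.cons a l) acc))) (by omega) (by omega)
    obtain ⟨s, hs, hr'⟩ := hp (.cons c (.cons (.cons a l) acc))
    have h6 : P.eval (TreeData.cons c (.cons (.cons a l) acc)).size ≤ P.eval (S + M + 2) := by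
      apply P.eval_nat_mono
      simp only [size] at hS ⊢
      omega
    have h7 : (l.size + 1) * (P.eval (S + M + 2) + 20) ≤
        (TreeData.cons a l).size * (P.eval (S + M + 2) + 20) :=
      Nat.mul_le_mul_right _ (by simp [size])
    rw [add_mul, one_mul] at h7
    refine ⟨_, ?_, .loopStep (.seq (.tl _) (.hd _)) (by simp [TreeData.hd, TreeData.tl])
      (.pair (.hd _) (.pair (.seq (.tl _) (.seq (.hd _) (.tl _))) hr')) hr⟩
    omega

theorem fold {g c l a : TreeData → TreeData} (hg : PolyTime g) (hG : AdditiveGrowth g)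
    (hc : PolyTime c) (hl : PolyTime l) (ha : PolyTime a) :
    PolyTime fun x => fold g (c x) (l x) (a x) := by
  suffices h : PolyTime fun x => TreeData.fold g x.hd x.tl.hd x.tl.tl from
    h.comp (hc.cons (hl.cons ha))
  -- The loop returns its whole final state; the result is read off from it by projections.
  suffices h : PolyTime fun x =>
      TreeData.cons x.hd (.cons .nil (TreeData.fold g x.hd x.tl.hd x.tl.tl)) from h.tl.tl
  obtain ⟨p, P, hp⟩ := hg
  obtain ⟨Q, hQ⟩ := hG
  have hp' : ∀ x, ∃ t ≤ P.eval x.size, p.Run x (g x) t := fun x => (hp x).2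
  refine ⟨.seq (.pair .hd (.pair (.seq .tl .hd) (.seq .tl .tl)))
    (.loop (.seq .tl .hd) (foldBody p)),
    X * (P.comp (X + X + (X + X * Q.comp (X + X)) + 2) + 20) + (X + X + X * Q.comp (X + X)) + 20,
    fun x => ?_⟩
  have h1 := size_hd_le x
  have h2 := (size_hd_le x.tl).trans (size_tl_le x)
  have h3 := (size_tl_le x.tl).trans (size_tl_le x)
  have h4 := size_fold_le hQ x.hd x.tl.hd x.tl.tl
  have h5 : x.tl.hd.size * Q.eval (x.hd.size + x.tl.hd.size) ≤
      x.size * Q.eval (x.size + x.size) :=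
    Nat.mul_le_mul h2 (Q.eval_nat_mono (by omega))
  have h5' : x.tl.hd.size * Q.eval (x.size + x.size) ≤ x.size * Q.eval (x.size + x.size) :=
    Nat.mul_le_mul_right _ h2
  obtain ⟨t, ht, hr⟩ := run_loop_foldBody hp' hQ x.hd (x.size + x.size)
    (x.size + x.size * Q.eval (x.size + x.size)) x.tl.hd x.tl.tl (by omega) (by omega)
  have h6 := ht.trans (Nat.mul_le_mul_right _ h2)
  simp only [eval_add, eval_mul, eval_X, eval_comp, eval_ofNat, size]
  refine ⟨by omega, _, ?_,
    .seq (.pair (.hd _) (.pair (.seq (.tl _) (.hd _)) (.seq (.tl _) (.tl _)))) hr⟩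
  omega

end PolyTime

/-- The increment is computed from the context and the list alone, so its polynomial size bound
cannot involve the accumulator. -/
theorem AdditiveGrowth.of_polyTime {g f : TreeData → TreeData} (hf : PolyTime f)
    (h : ∀ c l acc, (g (cons c (cons l acc))).size ≤ acc.size + (f (cons c l)).size) :
    AdditiveGrowth g := by
  obtain ⟨p, P, hp⟩ := hf
  refine ⟨P.comp (X + 1), fun c l acc => (h c l acc).trans ?_⟩
  have := (hp (cons c l)).1
  simpa [size] using this

/-! ### Arithmetic and lists on trees -/

theorem fold_ofList {A B : Type*} {enc : A → TreeData} {ρ : B → TreeData} {step : B → A → B}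
    {g : TreeData → TreeData} {c : TreeData}
    (h : ∀ a l acc, g (cons c (cons (ofList enc (a :: l)) (ρ acc))) = ρ (step acc a))
    (l : List A) (acc : B) :
    fold g c (ofList enc l) (ρ acc) = ρ (l.foldl step acc) := by
  induction l generalizing acc with
  | nil => rfl
  | cons a l ih =>
    have := h a l acc
    simp only [ofList] at this
    simp only [ofList, fold, this, ih, List.foldl_cons]

theorem ofList_map {A B : Type*} (enc : B → TreeData) (f : A → B) (l : List A) :
    ofList enc (l.map f) = ofList (fun a => enc (f a)) l := by
  induction l with
  | nil => rfl
  | cons a l ih => simp [ofList, ih]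

/-- Addition of unary numbers. -/
def add (a b : TreeData) : TreeData :=
  fold (fun s => cons nil s.tl.tl) nil a b

/-- Truncated subtraction of unary numbers. -/
def sub (a b : TreeData) : TreeData :=
  fold (fun s => s.tl.tl.tl) nil b a

theorem PolyTime.add {f g : TreeData → TreeData} (hf : PolyTime f) (hg : PolyTime g) :
    PolyTime fun x => add (f x) (g x) :=
  .fold (.cons .nil (.tl (.tl .id))) ⟨2, fun c l acc => by simp [size]; omega⟩ .nil hf hg

theorem PolyTime.sub {f g : TreeData → TreeData} (hf : PolyTime f) (hg : PolyTime g) :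
    PolyTime fun x => sub (f x) (g x) :=
  .fold (.tl (.tl (.tl .id))) ⟨0, fun c l acc => by simpa using size_tl_le acc⟩ .nil hg hf

theorem add_ofNat (m n : ℕ) : add (ofNat m) (ofNat n) = ofNat (m + n) := by
  unfold add
  induction m generalizing n with
  | zero => simp [ofNat, fold]
  | succ m ih =>
    have := ih (n + 1)
    simp only [ofNat, fold, tl_cons] at *
    rw [this, Nat.add_right_comm, Nat.add_assoc]
    rfl

theorem sub_ofNat (m n : ℕ) : sub (ofNat m) (ofNat n) = ofNat (m - n) := by
  unfold sub
  induction n generalizing m with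
  | zero => simp [ofNat, fold]
  | succ n ih =>
    have h : (ofNat m).tl = ofNat (m - 1) := by cases m <;> rfl
    simp only [ofNat, fold, tl_cons, h, ih]
    rw [Nat.sub_sub, Nat.add_comm]

/-- The maximum of two unary numbers. -/
def max (a b : TreeData) : TreeData :=
  cond (sub a b) a b

theorem size_max_le (a b : TreeData) : (max a b).size ≤ a.size + b.size := by
  unfold max cond
  split <;> omega

theorem max_ofNat (m n : ℕ) : max (ofNat m) (ofNat n) = ofNat (Max.max m n) := by
  rw [max, sub_ofNat]
  rcases le_total m n with h | h
  · simp [Nat.sub_eq_zero_of_le h, h, ofNat, cond]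
  · rcases h.eq_or_lt with rfl | h
    · simp [ofNat, cond]
    · obtain ⟨k, hk⟩ := Nat.exists_eq_succ_of_ne_zero (Nat.sub_ne_zero_of_lt h)
      simp [hk, ofNat, cond, h.le]

/-- Whether a unary number occurs in a list. -/
def mem (v l : TreeData) : TreeData :=
  fold (fun s => cond (add (sub s.hd s.tl.hd.hd) (sub s.tl.hd.hd s.hd)) s.tl.tl (cons nil nil))
    v l nil

theorem PolyTime.mem {f g : TreeData → TreeData} (hf : PolyTime f) (hg : PolyTime g) :
    PolyTime fun x => mem (f x) (g x) := by
  have h1 : PolyTime fun s : TreeData => s.tl.hd.hd := .hd (.hd (.tl .id))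
  refine .fold (.cond (.add (.sub (.hd .id) h1) (.sub h1 (.hd .id))) (.tl (.tl .id))
    (.cons .nil .nil)) ⟨3, fun c l acc => ?_⟩ hf hg .nil
  simp only [hd_cons, tl_cons, TreeData.cond]
  split <;> simp [size]

theorem mem_ofNat (v : ℕ) (l : List ℕ) : mem (ofNat v) (ofList ofNat l) ≠ nil ↔ v ∈ l := by
  unfold mem
  have key := fold_ofList (enc := ofNat) (c := ofNat v)
    (g := fun s => cond (add (sub s.hd s.tl.hd.hd) (sub s.tl.hd.hd s.hd)) s.tl.tl (cons nil nil))
    (ρ := fun b : Bool => if b then cons nil nil else nil)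
    (step := fun b a => decide (a = v) || b) ?_ l false
  · simp only [Bool.false_eq_true, if_false] at key
    rw [key]
    have : ∀ b, l.foldl (fun b a => decide (a = v) || b) b = true ↔ v ∈ l ∨ b = true := by
      clear key
      induction l with
      | nil => simp
      | cons a l ih =>
        intro b
        rw [List.foldl_cons, ih, List.mem_cons, Bool.or_eq_true, decide_eq_true_iff, eq_comm]
        tauto
    split <;> simp_all
  · intro a l b
    simp only [hd_cons, tl_cons, ofList, sub_ofNat, add_ofNat]
    -- The two truncated differences add up to `|a - v|`, which is the empty tree exactly when the
    -- numbers agree.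
    by_cases h : a = v
    · simp [h, ofNat, cond]
    · obtain ⟨k, hk⟩ := Nat.exists_eq_succ_of_ne_zero (show v - a + (a - v) ≠ 0 by omega)
      simp [h, hk, ofNat, cond]

/-- The number of `v < n` in a list. -/
def count (n l : TreeData) : TreeData :=
  fold (fun s => cond (mem s.tl.hd.tl s.hd) (cons nil s.tl.tl) s.tl.tl) l n nil

theorem PolyTime.count {f g : TreeData → TreeData} (hf : PolyTime f) (hg : PolyTime g) :
    PolyTime fun x => count (f x) (g x) := by
  refine .fold (.cond (.mem (.tl (.hd (.tl .id))) (.hd .id)) (.cons .nil (.tl (.tl .id)))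
    (.tl (.tl .id))) ⟨2, fun c l acc => ?_⟩ hg hf .nil
  simp only [hd_cons, tl_cons, TreeData.cond]
  split <;> simp [size]; omega

/-- Bags are lists that may repeat a vertex. Counting the numbers below `n` that occur, rather than
the entries, gives the cardinality of the set. The numeral `n` serves as the list of the fold, and
its tail is the number being tested. -/
theorem count_ofNat (n : ℕ) (l : List ℕ) :
    count (ofNat n) (ofList ofNat l) = ofNat ((Finset.range n).filter (· ∈ l)).card := by
  suffices h : ∀ k, fold (fun s => cond (mem s.tl.hd.tl s.hd) (cons nil s.tl.tl) s.tl.tl)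
      (ofList ofNat l) (ofNat n) (ofNat k) =
      ofNat (((Finset.range n).filter (· ∈ l)).card + k) from h 0
  induction n with
  | zero => simp [fold, ofNat]
  | succ n ih =>
    intro k
    simp only [ofNat, fold, hd_cons, tl_cons]
    rw [Finset.range_add_one, Finset.filter_insert]
    by_cases h : n ∈ l
    · have h' := (mem_ofNat n l).2 h
      have : cond (mem (ofNat n) (ofList ofNat l)) (cons nil (ofNat k)) (ofNat k) =
          ofNat (k + 1) := by
        cases hm : mem (ofNat n) (ofList ofNat l) with
        | nil => exact absurd hm h'
        | cons a b => rfl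
      rw [this, ih, if_pos h, Finset.card_insert_of_notMem (by simp)]
      congr 1
      omega
    · have h' : mem (ofNat n) (ofList ofNat l) = nil := by
        by_contra hm
        exact h ((mem_ofNat n l).1 hm)
      rw [h', if_neg h]
      exact ih k

/-- The maximum of `count n l` over the entries of a list of lists. -/
def maxCount (n L : TreeData) : TreeData :=
  fold (fun s => max s.tl.tl (count s.hd s.tl.hd.hd)) n L nil

theorem PolyTime.maxCount {f g : TreeData → TreeData} (hf : PolyTime f) (hg : PolyTime g) :
    PolyTime fun x => maxCount (f x) (g x) := by
  have h : PolyTime fun s => TreeData.count s.hd s.tl.hd.hd :=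
    .count (.hd .id) (.hd (.hd (.tl .id)))
  have h' : PolyTime fun s => TreeData.count s.hd s.tl.hd :=
    .count (.hd .id) (.hd (.tl .id))
  have h2 : PolyTime fun s : TreeData => s.tl.tl := .tl (.tl .id)
  exact .fold (.cond (.sub h2 h) h2 h) (.of_polyTime h' fun c l acc => size_max_le _ _) hf hg .nil

theorem maxCount_ofNat (n : ℕ) (L : List (List ℕ)) :
    maxCount (ofNat n) (ofList (ofList ofNat) L) =
      ofNat (L.foldl (fun m l => Max.max m ((Finset.range n).filter (· ∈ l)).card) 0) := by
  unfold maxCount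
  exact fold_ofList (ρ := ofNat) (acc := 0) (fun a l acc => by
    simp only [hd_cons, tl_cons, ofList, count_ofNat, max_ofNat]) L

/-- The list of the `N` unary numbers from `b` on, put in front of a list. -/
def rangeOnto (b N acc : TreeData) : TreeData :=
  fold (fun s => cons (add s.tl.hd.tl s.hd) s.tl.tl) b N acc

theorem PolyTime.rangeOnto {f g a : TreeData → TreeData} (hf : PolyTime f) (hg : PolyTime g)
    (ha : PolyTime a) : PolyTime fun x => rangeOnto (f x) (g x) (a x) := by
  have h : PolyTime fun s => TreeData.cons (TreeData.add s.tl.tl s.hd) .nil :=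
    .cons (.add (.tl (.tl .id)) (.hd .id)) .nil
  refine .fold (.cons (.add (.tl (.hd (.tl .id))) (.hd .id)) (.tl (.tl .id)))
    (.of_polyTime h fun c l acc => ?_) hf hg ha
  simp [size]
  omega

/-- The numeral counts down while entries are prepended, so the numbers come out in ascending order.
-/
theorem rangeOnto_ofNat (b N : ℕ) (l : List ℕ) :
    rangeOnto (ofNat b) (ofNat N) (ofList ofNat l) =
      ofList ofNat ((List.range N).map (b + ·) ++ l) := by
  unfold rangeOnto
  induction N generalizing l with
  | zero => simp [ofNat, fold]
  | succ N ih =>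
    have := ih ((b + N) :: l)
    simp only [ofNat, fold, hd_cons, tl_cons, add_ofNat, ofList] at *
    rw [Nat.add_comm N b, this, List.range_succ]
    simp

/-- All pairs of entries of two lists, put in front of a list. -/
def prodOnto (A B acc : TreeData) : TreeData :=
  fold (fun s => fold (fun r => cons (cons r.hd r.tl.hd.hd) r.tl.tl) s.tl.hd.hd s.hd s.tl.tl)
    B A acc

theorem PolyTime.prodOnto {f g a : TreeData → TreeData} (hf : PolyTime f) (hg : PolyTime g)
    (ha : PolyTime a) : PolyTime fun x => prodOnto (f x) (g x) (a x) := by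
  have hQ : ∀ c l acc : TreeData,
      ((fun r : TreeData => TreeData.cons (.cons r.hd r.tl.hd.hd) r.tl.tl)
        (.cons c (.cons l acc))).size ≤ acc.size + (X + 2 : ℕ[X]).eval (c.size + l.size) := by
    intro c l acc
    have := size_hd_le l
    simp [size]
    omega
  refine .fold (.fold (.cons (.cons (.hd .id) (.hd (.hd (.tl .id)))) (.tl (.tl .id)))
    ⟨_, hQ⟩ (.hd (.hd (.tl .id))) (.hd .id) (.tl (.tl .id)))
    -- The growth of one complete inner fold: at most `X` rounds, each adding at most `X + 2`.
    ⟨X * (X + 2), fun c l acc => ?_⟩ hg hf ha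
  refine (size_fold_le hQ _ _ _).trans ?_
  have := size_hd_le l
  simp only [hd_cons, tl_cons, eval_mul, eval_X, eval_add, eval_ofNat]
  exact Nat.add_le_add_left (Nat.mul_le_mul (by omega) (by omega)) _

theorem prodOnto_ofList {A : Type*} (enc : A → TreeData) (l m : List A) (acc : List (A × A)) :
    prodOnto (ofList enc l) (ofList enc m) (ofList (fun e => cons (enc e.1) (enc e.2)) acc) =
      ofList (fun e => cons (enc e.1) (enc e.2))
        (l.foldl (fun acc a => m.foldl (fun acc b => (a, b) :: acc) acc) acc) := by
  unfold prodOnto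
  refine fold_ofList (ρ := ofList fun e : A × A => cons (enc e.1) (enc e.2)) (fun a l acc => ?_) _ _
  simp only [hd_cons, tl_cons, ofList]
  refine fold_ofList (ρ := ofList fun e : A × A => cons (enc e.1) (enc e.2)) (fun b m acc => ?_) _ _
  simp [ofList]

/-- Put every entry of `B` in front of the list `l`; the resulting lists go in front of `acc`. -/
def consOnto (l B acc : TreeData) : TreeData :=
  fold (fun s => cons (cons s.tl.hd.hd s.hd) s.tl.tl) l B acc

theorem PolyTime.consOnto {f g a : TreeData → TreeData} (hf : PolyTime f) (hg : PolyTime g)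
    (ha : PolyTime a) : PolyTime fun x => consOnto (f x) (g x) (a x) := by
  refine .fold (.cons (.cons (.hd (.hd (.tl .id))) (.hd .id)) (.tl (.tl .id)))
    ⟨X + 2, fun c l acc => ?_⟩ hf hg ha
  have := size_hd_le l
  simp [size]
  omega

theorem consOnto_ofList {A : Type*} (enc : A → TreeData) (l m : List A) (acc : List (List A)) :
    consOnto (ofList enc l) (ofList enc m) (ofList (ofList enc) acc) =
      ofList (ofList enc) (m.foldl (fun acc b => (b :: l) :: acc) acc) := by
  unfold consOnto
  exact fold_ofList (ρ := ofList (ofList enc)) (fun b m acc => by simp [ofList]) _ _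

/-- Put the numbers `n, …, n + h - 1` into every list of a list of lists. -/
def addRange (h : ℕ) (n L : TreeData) : TreeData :=
  fold (fun s => cons (rangeOnto s.hd (ofNat h) s.tl.hd.hd) s.tl.tl) n L nil

theorem PolyTime.addRange (h : ℕ) {f g : TreeData → TreeData} (hf : PolyTime f)
    (hg : PolyTime g) : PolyTime fun x => addRange h (f x) (g x) := by
  have h1 : PolyTime fun s => TreeData.cons (TreeData.rangeOnto s.hd (ofNat h) s.tl.hd) .nil :=
    .cons (.rangeOnto (.hd .id) (.const _) (.hd (.tl .id))) .nil
  refine .fold (.cons (.rangeOnto (.hd .id) (.const _) (.hd (.hd (.tl .id)))) (.tl (.tl .id)))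
    (.of_polyTime h1 fun c l acc => ?_) hf hg .nil
  simp [size]
  omega

theorem addRange_ofNat (h n : ℕ) (L : List (List ℕ)) :
    addRange h (ofNat n) (ofList (ofList ofNat) L) = ofList (ofList ofNat)
      (L.foldl (fun acc l => ((List.range h).map (n + ·) ++ l) :: acc) []) := by
  unfold addRange
  exact fold_ofList (ρ := ofList (ofList ofNat)) (acc := []) (fun l L acc => by
    simp only [ofList, hd_cons, tl_cons, rangeOnto_ofNat]) _

/-- Put a fixed list of pairs of numbers, shifted by `n`, in front of a list. -/
def pairsOnto : List (ℕ × ℕ) → TreeData → TreeData → TreeData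
  | [], _, acc => acc
  | e :: l, n, acc =>
    cons (cons (add (ofNat e.1) n) (add (ofNat e.2) n)) (pairsOnto l n acc)

/-- The list belongs to the fixed target, so the recursion unrolls into a program without loops over
it. -/
theorem PolyTime.pairsOnto (l : List (ℕ × ℕ)) {f g : TreeData → TreeData} (hf : PolyTime f)
    (hg : PolyTime g) : PolyTime fun x => pairsOnto l (f x) (g x) := by
  induction l with
  | nil => exact hg
  | cons e l ih => exact .cons (.cons (.add (.const _) hf) (.add (.const _) hf)) ih

theorem pairsOnto_ofNat (l : List (ℕ × ℕ)) (n : ℕ) (acc : List (ℕ × ℕ)) :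
    pairsOnto l (ofNat n) (ofList (fun e => cons (ofNat e.1) (ofNat e.2)) acc) =
      ofList (fun e => cons (ofNat e.1) (ofNat e.2))
        (l.map (fun e => (e.1 + n, e.2 + n)) ++ acc) := by
  induction l with
  | nil => rfl
  | cons e l ih => simp [pairsOnto, ofList, ih, add_ofNat]

end TreeData

/-! ### Path decompositions -/

namespace LGraph

theorem maxBag_le_iff {V : Type*} {B : List (Finset V)} {m : ℕ} :
    maxBag B ≤ m ↔ ∀ X ∈ B, X.card ≤ m := by
  induction B with
  | nil => simp [maxBag]
  | cons X B ih =>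
    have : maxBag (X :: B) = max X.card (maxBag B) := rfl
    simp [this, ih]

theorem card_le_maxBag {V : Type*} {B : List (Finset V)} {X : Finset V} (hX : X ∈ B) :
    X.card ≤ maxBag B :=
  maxBag_le_iff.1 le_rfl X hX

/-- The bags that contain `v` are consecutive. -/
def IsInterval {V : Type*} (B : List (Finset V)) (v : V) : Prop :=
  ∀ i j k : ℕ, ∀ (hij : i ≤ j) (hjk : j ≤ k) (hk : k < B.length),
    v ∈ B[i] → v ∈ B[k] → v ∈ B[j]

namespace IsInterval

variable {V : Type*} {B C : List (Finset V)} {v : V}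

theorem append_left (hB : IsInterval B v) (hC : ∀ X ∈ C, v ∉ X) : IsInterval (B ++ C) v := by
  intro i j k hij hjk hk hi hj
  have hkB : k < B.length := by
    by_contra h
    rw [List.getElem_append_right (by omega)] at hj
    exact hC _ (List.getElem_mem _) hj
  rw [List.getElem_append_left (by omega)] at *
  exact hB i j k hij hjk hkB hi hj

theorem append_right (hC : IsInterval C v) (hB : ∀ X ∈ B, v ∉ X) : IsInterval (B ++ C) v := by
  intro i j k hij hjk hk hi hj
  have hiB : B.length ≤ i := by
    by_contra h
    rw [List.getElem_append_left (by omega)] at hi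
    exact hB _ (List.getElem_mem _) hi
  rw [List.length_append] at hk
  rw [List.getElem_append_right (by omega)] at *
  exact hC _ _ (k - B.length) (by omega) (by omega) (by omega) hi hj

theorem reverse (hB : IsInterval B v) : IsInterval B.reverse v := by
  intro i j k hij hjk hk hi hj
  rw [List.length_reverse] at hk
  rw [List.getElem_reverse] at *
  exact hB _ _ (B.length - 1 - i) (by omega) (by omega) (by omega) hj hi

theorem of_forall_mem (h : ∀ X ∈ B, v ∈ X) : IsInterval B v :=
  fun _ _ _ _ _ _ _ _ => h _ (List.getElem_mem _)

end IsInterval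

theorem IsPathDecomposition.isInterval {V : Type*} {G : LGraph V} {B : List (Finset V)}
    (h : G.IsPathDecomposition B) (v : V) : IsInterval B v :=
  fun i j k hij hjk hk => h.interval ⟨i, by omega⟩ ⟨j, by omega⟩ ⟨k, hk⟩ v hij hjk

/-- If every vertex of a nonempty set has `N` neighbours in that set, other than itself, then some
bag of every path decomposition has more than `N` elements. -/
theorem IsPathDecomposition.lt_maxBag {V : Type*} {G : LGraph V} {B : List (Finset V)}
    (h : G.IsPathDecomposition B) {S : Finset V} (hS : S.Nonempty) {N : ℕ}
    (hN : ∀ v ∈ S, ∃ T ⊆ S, v ∉ T ∧ T.card = N ∧ ∀ w ∈ T, G.Adj v w) : N < maxBag B := by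
  classical
  let idx : V → Finset (Fin B.length) := fun v => Finset.univ.filter fun i => v ∈ B[i]
  have hidx : ∀ v, (idx v).Nonempty := by
    intro v
    obtain ⟨X, hX, hv⟩ := h.vertex v
    obtain ⟨i, hi, rfl⟩ := List.getElem_of_mem hX
    exact ⟨⟨i, hi⟩, by simpa [idx] using hv⟩
  let last : V → Fin B.length := fun v => (idx v).max' (hidx v)
  have hlast : ∀ v, v ∈ B[last v] := fun v => by
    have := (idx v).max'_mem (hidx v)
    simpa only [idx, Finset.mem_filter, Finset.mem_univ, true_and] using this
  have hle : ∀ v i, v ∈ B[i] → i ≤ last v := fun v i hi =>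
    (idx v).le_max' i (by simpa only [idx, Finset.mem_filter, Finset.mem_univ, true_and] using hi)
  -- Take `v` in `S` whose last bag comes first. Each neighbour in `S` meets `v` no later than that
  -- bag and disappears no earlier, so that bag contains all of them.
  obtain ⟨v, hv, hmin⟩ := S.exists_min_image last hS
  obtain ⟨T, hTS, hvT, rfl, hT⟩ := hN v hv
  have hsub : insert v T ⊆ B[last v] := by
    rw [Finset.insert_subset_iff]
    refine ⟨hlast v, fun w hw => ?_⟩
    obtain ⟨X, hX, hvX, hwX⟩ := h.edge v w (hT w hw)
    obtain ⟨i, hi, rfl⟩ := List.getElem_of_mem hX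
    exact h.interval ⟨i, hi⟩ _ (last w) w (hle v ⟨i, hi⟩ hvX) (hmin w (hTS hw)) hwX (hlast w)
  have h1 := Finset.card_le_card hsub
  rw [Finset.card_insert_of_notMem hvT] at h1
  exact h1.trans (card_le_maxBag (List.getElem_mem _))

end LGraph

/-! ### The extended instance -/

namespace HomInput

/-- The number of vertices on each side of the complete bipartite graph in `extend`. -/
def padding (I : HomInput) (h : ℕ) : ℕ :=
  h + LGraph.maxBag I.bagSets

variable (I : HomInput) (h : ℕ)

/-- The number of vertices of the extended instance. -/
abbrev extendN : ℕ :=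
  I.n + h + (I.padding h + I.padding h)

/-- The vertices of the original instance. -/
def inG (x : Fin I.n) : Fin (I.extendN h) :=
  (x.castAdd h).castAdd _

/-- The vertices of the additional target component. -/
def inT (j : Fin h) : Fin (I.extendN h) :=
  (j.natAdd I.n).castAdd _

/-- One side of the complete bipartite graph. -/
def inA (j : Fin (I.padding h)) : Fin (I.extendN h) :=
  (j.castAdd _).natAdd _

/-- The other side of the complete bipartite graph. -/
def inB (j : Fin (I.padding h)) : Fin (I.extendN h) :=
  (j.natAdd _).natAdd _

variable {I h}

@[elab_as_elim]
theorem extend_cases {P : Fin (I.extendN h) → Prop} (hG : ∀ x, P (I.inG h x))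
    (hT : ∀ x, P (I.inT h x)) (hA : ∀ x, P (I.inA h x)) (hB : ∀ x, P (I.inB h x)) (x) : P x :=
  Fin.addCases (Fin.addCases hG hT) (Fin.addCases hA hB) x

/-- Define a function on the vertices of the extended instance by cases. -/
def extendFun {W : Type*} (f : Fin I.n → W) (g : Fin h → W) (a b : W) (x : Fin (I.extendN h)) :
    W :=
  Fin.addCases (motive := fun _ => W) (Fin.addCases (motive := fun _ => W) f g)
    (Fin.addCases (motive := fun _ => W) (fun _ => a) (fun _ => b)) x

section

variable {W : Type*} (f : Fin I.n → W) (g : Fin h → W) (a b : W)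

@[simp] theorem extendFun_inG (x) : extendFun f g a b (I.inG h x) = f x := by
  simp [extendFun, inG]

@[simp] theorem extendFun_inT (x) : extendFun f g a b (I.inT h x) = g x := by
  simp [extendFun, inT]

@[simp] theorem extendFun_inA (x) : extendFun f g a b (I.inA h x) = a := by
  simp [extendFun, inA]

@[simp] theorem extendFun_inB (x) : extendFun f g a b (I.inB h x) = b := by
  rw [extendFun, inB, Fin.addCases_right, Fin.addCases_right]

end

@[simp] theorem val_inG (x) : (I.inG h x : ℕ) = x := rfl

@[simp] theorem val_inT (x) : (I.inT h x : ℕ) = I.n + x := rfl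

@[simp] theorem val_inA (x) : (I.inA h x : ℕ) = I.n + h + x := rfl

@[simp] theorem val_inB (x) : (I.inB h x : ℕ) = I.n + h + (I.padding h + x) := rfl

theorem inG_injective : Function.Injective (I.inG h) := fun x y e => by
  simpa [Fin.ext_iff] using e

theorem inA_injective : Function.Injective (I.inA h) := fun x y e => by
  simpa [Fin.ext_iff] using e

theorem inB_injective : Function.Injective (I.inB h) := fun x y e => by
  simpa [Fin.ext_iff] using e

@[simp] theorem inG_inj {x y} : I.inG h x = I.inG h y ↔ x = y := inG_injective.eq_iff

@[simp] theorem inB_inj {x y} : I.inB h x = I.inB h y ↔ x = y := inB_injective.eq_iff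

@[simp] theorem inG_ne_inT (x y) : I.inG h x ≠ I.inT h y := fun e => by
  have := Fin.ext_iff.1 e
  simp only [val_inG, val_inT] at this
  omega

@[simp] theorem inG_ne_inA (x y) : I.inG h x ≠ I.inA h y := fun e => by
  have := Fin.ext_iff.1 e
  simp only [val_inG, val_inA] at this
  omega

@[simp] theorem inG_ne_inB (x y) : I.inG h x ≠ I.inB h y := fun e => by
  have := Fin.ext_iff.1 e
  simp only [val_inG, val_inB] at this
  omega

@[simp] theorem inT_ne_inA (x y) : I.inT h x ≠ I.inA h y := fun e => by
  have := Fin.ext_iff.1 e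
  simp only [val_inT, val_inA] at this
  omega

@[simp] theorem inT_ne_inB (x y) : I.inT h x ≠ I.inB h y := fun e => by
  have := Fin.ext_iff.1 e
  simp only [val_inT, val_inB] at this
  omega

@[simp] theorem inA_ne_inB (x y) : I.inA h x ≠ I.inB h y := fun e => by
  have := Fin.ext_iff.1 e
  simp only [val_inA, val_inB] at this
  omega

variable (I h)

/-- One side of the complete bipartite graph. -/
def sideA : List (Fin (I.extendN h)) :=
  (List.finRange (I.padding h)).map (I.inA h)

/-- The other side of the complete bipartite graph. -/
def sideB : List (Fin (I.extendN h)) :=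
  (List.finRange (I.padding h)).map (I.inB h)

/-- A bag of the instance, with the vertices of the additional target component. -/
def extendBag (X : List (Fin I.n)) : List (Fin (I.extendN h)) :=
  (List.finRange h).map (I.inT h) ++ X.map (I.inG h)

/-- The edges of `extend`. -/
def extendEdges (E : List (Fin h × Fin h)) (v : Fin I.n) (u : Fin h) :
    List (Fin (I.extendN h) × Fin (I.extendN h)) :=
  (I.sideA h).foldl (fun acc a => (I.sideB h).foldl (fun acc b => (a, b) :: acc) acc)
    ((I.inG h v, I.inT h u) :: (E.map (Prod.map (I.inT h) (I.inT h)) ++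
      I.edges.map (Prod.map (I.inG h) (I.inG h))))

/-- The bags of `extend`. -/
def extendBags : List (List (Fin (I.extendN h))) :=
  (I.sideB h).foldl (fun acc b => (b :: I.sideA h) :: acc)
    (I.bags.foldl (fun acc X => I.extendBag h X :: acc) [])

/-- The instance together with a copy of a graph on `h` vertices with edge list `E`, an edge from
the vertex `v` of the instance to the vertex `u` of the copy, and a complete bipartite graph that
determines the pathwidth. -/
def extend (E : List (Fin h × Fin h)) (v : Fin I.n) (u : Fin h) : HomInput where
  n := I.extendN h
  edges := I.extendEdges h E v u
  bags := I.extendBags h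

/-- The graph of the extended instance. -/
def extendGraph (E : List (Fin h × Fin h)) (v : Fin I.n) (u : Fin h) :
    LGraph (Fin (I.extendN h)) where
  Adj x y := (x, y) ∈ I.extendEdges h E v u ∨ (y, x) ∈ I.extendEdges h E v u
  symm _ _ h := h.symm

/-- The bags of the extended instance. -/
def extendBagSets : List (Finset (Fin (I.extendN h))) :=
  ((I.bags.map fun X => (I.extendBag h X).toFinset) ++
    (I.sideB h).map fun b => (b :: I.sideA h).toFinset).reverse

variable {I h} {E : List (Fin h × Fin h)} {v : Fin I.n} {u : Fin h}

/-! ### Edges, path decomposition and pathwidth of the extended instance -/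

theorem foldl_cons_eq {A B : Type*} (f : A → B) (l : List A) (acc : List B) :
    l.foldl (fun acc a => f a :: acc) acc = (l.map f).reverse ++ acc := by
  induction l generalizing acc <;> simp_all

theorem mem_foldl_foldl_cons {A B : Type*} (l : List A) (m : List B) (acc : List (A × B))
    (e : A × B) :
    e ∈ l.foldl (fun acc a => m.foldl (fun acc b => (a, b) :: acc) acc) acc ↔
      e.1 ∈ l ∧ e.2 ∈ m ∨ e ∈ acc := by
  obtain ⟨x, y⟩ := e
  induction l generalizing acc with
  | nil => simp
  | cons a l ih =>
    rw [List.foldl_cons, ih, foldl_cons_eq]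
    simp only [List.mem_append, List.mem_reverse, List.mem_map, Prod.mk.injEq, List.mem_cons]
    constructor
    · rintro (h | ⟨b, hb, rfl, rfl⟩ | h) <;> tauto
    · rintro (⟨rfl | h, h'⟩ | h)
      · exact .inr (.inl ⟨y, h', rfl, rfl⟩)
      · exact .inl ⟨h, h'⟩
      · exact .inr (.inr h)

theorem mem_extend_edges {x y : Fin (I.extendN h)} :
    (x, y) ∈ I.extendEdges h E v u ↔
      (∃ i j, x = I.inA h i ∧ y = I.inB h j) ∨ (x = I.inG h v ∧ y = I.inT h u) ∨
      (∃ i j, (i, j) ∈ E ∧ x = I.inT h i ∧ y = I.inT h j) ∨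
      ∃ i j, (i, j) ∈ I.edges ∧ x = I.inG h i ∧ y = I.inG h j := by
  have := mem_foldl_foldl_cons (I.sideA h) (I.sideB h)
    ((I.inG h v, I.inT h u) :: (E.map (Prod.map (I.inT h) (I.inT h)) ++
      I.edges.map (Prod.map (I.inG h) (I.inG h)))) (x, y)
  refine this.trans ?_
  simp [sideA, sideB, eq_comm]

theorem map_toFinset_extendBags :
    (I.extendBags h).map List.toFinset = I.extendBagSets h := by
  rw [extendBags, foldl_cons_eq, foldl_cons_eq, extendBagSets, List.append_nil,
    ← List.reverse_append, List.map_reverse, List.map_append, List.map_map, List.map_map]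
  rfl

@[simp] theorem mem_extendBag_inG {X : List (Fin I.n)} {x} :
    I.inG h x ∈ I.extendBag h X ↔ x ∈ X := by
  simp [extendBag, (inG_ne_inT _ _).symm]

@[simp] theorem mem_extendBag_inT {X : List (Fin I.n)} {x} : I.inT h x ∈ I.extendBag h X := by
  simp [extendBag]

@[simp] theorem notMem_extendBag_inA {X : List (Fin I.n)} {x} :
    I.inA h x ∉ I.extendBag h X := by
  simp [extendBag]

@[simp] theorem notMem_extendBag_inB {X : List (Fin I.n)} {x} :
    I.inB h x ∉ I.extendBag h X := by
  simp [extendBag]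

theorem isInterval_extendBag {x : Fin I.n} (hx : LGraph.IsInterval I.bagSets x) :
    LGraph.IsInterval (I.bags.map fun X => (I.extendBag h X).toFinset) (I.inG h x) := by
  intro i j k hij hjk hk hi hj
  rw [List.length_map] at hk
  have := hx i j k hij hjk (by simpa [bagSets] using hk)
  simp only [bagSets, List.getElem_map, List.mem_toFinset, mem_extendBag_inG] at *
  exact this hi hj

/-- Each vertex of this side lies in exactly one of these bags. -/
theorem isInterval_sideB (x : Fin (I.padding h)) :
    LGraph.IsInterval ((I.sideB h).map fun b => (b :: I.sideA h).toFinset) (I.inB h x) := by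
  intro i j k hij hjk hk hi hj
  have key : ∀ i (hi : i < ((I.sideB h).map fun b => (b :: I.sideA h).toFinset).length),
      I.inB h x ∈ ((I.sideB h).map fun b => (b :: I.sideA h).toFinset)[i] ↔ i = x := by
    intro i hi
    simp [sideB, sideA, Fin.ext_iff (a := x), eq_comm]
  rw [key] at *
  omega

/-- Before the reversal, the bags of the instance, each enlarged by the whole target component,
precede the bags `A ∪ {b}`. No edge joins the two blocks, and no vertex occurs in both. -/
theorem isPathDecomposition_extend (hI : I.graph.IsPathDecomposition I.bagSets) :
    (I.extendGraph h E v u).IsPathDecomposition (I.extendBagSets h) := by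
  have hex : ∀ x : Fin I.n, ∃ X ∈ I.bags, x ∈ X := by
    simpa [bagSets] using hI.vertex
  have hedge : ∀ x y : Fin I.n, (x, y) ∈ I.edges → ∃ X ∈ I.bags, x ∈ X ∧ y ∈ X := by
    intro x y hxy
    simpa [bagSets] using hI.edge x y (.inl hxy)
  -- The vertex `v` guarantees a bag of the instance, which is needed to cover the target component.
  obtain ⟨X₀, hX₀, -⟩ := hex v
  unfold extendBagSets
  constructor
  · have := List.ne_nil_of_mem hX₀
    rw [Ne, List.reverse_eq_nil_iff, List.append_eq_nil_iff, List.map_eq_nil_iff]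
    exact fun h => this h.1
  · intro x
    simp only [List.mem_reverse, List.mem_append, List.mem_map]
    induction x using extend_cases with
    | hG x =>
      obtain ⟨X, hX, hx⟩ := hex x
      exact ⟨_, .inl ⟨X, hX, rfl⟩, by simpa using hx⟩
    | hT x => exact ⟨_, .inl ⟨X₀, hX₀, rfl⟩, by simp⟩
    | hA x => exact ⟨_, .inr ⟨I.inB h x, by simp [sideB], rfl⟩, by simp [sideA]⟩
    | hB x => exact ⟨_, .inr ⟨I.inB h x, by simp [sideB], rfl⟩, by simp⟩
  · suffices H : ∀ x y, (x, y) ∈ I.extendEdges h E v u →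
        ∃ X ∈ ((I.bags.map fun X => (I.extendBag h X).toFinset) ++
          (I.sideB h).map fun b => (b :: I.sideA h).toFinset).reverse, x ∈ X ∧ y ∈ X by
      rintro x y (h | h)
      · exact H x y h
      · obtain ⟨X, hX, h1, h2⟩ := H y x h
        exact ⟨X, hX, h2, h1⟩
    intro x y hxy
    simp only [List.mem_reverse, List.mem_append, List.mem_map]
    rcases mem_extend_edges.1 hxy with ⟨i, j, rfl, rfl⟩ | ⟨rfl, rfl⟩ | ⟨i, j, -, rfl, rfl⟩ |
      ⟨i, j, hij, rfl, rfl⟩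
    · exact ⟨_, .inr ⟨I.inB h j, by simp [sideB], rfl⟩, by simp [sideA], by simp⟩
    · obtain ⟨X, hX, hx⟩ := hex v
      exact ⟨_, .inl ⟨X, hX, rfl⟩, by simpa using hx, by simp⟩
    · exact ⟨_, .inl ⟨X₀, hX₀, rfl⟩, by simp, by simp⟩
    · obtain ⟨X, hX, hi, hj⟩ := hedge i j hij
      exact ⟨_, .inl ⟨X, hX, rfl⟩, by simpa using hi, by simpa using hj⟩
  · suffices H : ∀ x, LGraph.IsInterval
        ((I.bags.map fun X => (I.extendBag h X).toFinset) ++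
          (I.sideB h).map fun b => (b :: I.sideA h).toFinset).reverse x from
      fun i j k x hij hjk => H x i j k hij hjk k.2
    refine fun x => LGraph.IsInterval.reverse ?_
    induction x using extend_cases with
    | hG x => exact (isInterval_extendBag (hI.isInterval x)).append_left (by
        simp [sideA, sideB, (inG_ne_inA _ _).symm])
    | hT x => exact (LGraph.IsInterval.of_forall_mem (by simp)).append_left (by
        simp [sideA, sideB, (inT_ne_inA _ _).symm])
    | hA x => exact (LGraph.IsInterval.of_forall_mem (by simp [sideA])).append_right (by simp)
    | hB x => exact (isInterval_sideB x).append_right (by simp)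

theorem maxBag_extend_le :
    LGraph.maxBag (I.extendBagSets h) ≤ I.padding h + 1 := by
  rw [extendBagSets, LGraph.maxBag_le_iff]
  simp only [List.mem_reverse, List.mem_append, List.mem_map]
  rintro _ (⟨X, hX, rfl⟩ | ⟨b, -, rfl⟩)
  · have h1 : X.toFinset.card ≤ LGraph.maxBag I.bagSets :=
      LGraph.card_le_maxBag (List.mem_map_of_mem hX)
    have h2 : (I.extendBag h X).toFinset =
        ((List.finRange h).map (I.inT h)).toFinset ∪ X.toFinset.image (I.inG h) := by
      ext; simp [extendBag]
    rw [h2]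
    refine (Finset.card_union_le _ _).trans ?_
    have h3 := List.toFinset_card_le ((List.finRange h).map (I.inT h))
    have h4 := Finset.card_image_le (s := X.toFinset) (f := I.inG h)
    simp only [List.length_map, List.length_finRange] at h3
    unfold padding
    omega
  · exact (List.toFinset_card_le _).trans (by simp [sideA])

/-- Every vertex of the complete bipartite graph has `I.padding h` neighbours on the other side. -/
theorem padding_lt_maxBag (hh : 0 < h) {B : List (Finset (Fin (I.extendN h)))}
    (hB : (I.extendGraph h E v u).IsPathDecomposition B) :
    I.padding h < LGraph.maxBag B := by
  have hp : 0 < I.padding h := by unfold padding; omega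
  refine hB.lt_maxBag (S := Finset.univ.image (I.inA h) ∪ Finset.univ.image (I.inB h))
    ⟨I.inA h ⟨0, hp⟩, by simp⟩ fun w hw => ?_
  simp only [Finset.mem_union, Finset.mem_image, Finset.mem_univ, true_and] at hw
  rcases hw with ⟨i, rfl⟩ | ⟨i, rfl⟩
  · refine ⟨Finset.univ.image (I.inB h), Finset.subset_union_right, ?_, ?_, ?_⟩
    · simp [(inA_ne_inB _ _).symm]
    · rw [Finset.card_image_of_injective _ inB_injective, Finset.card_univ, Fintype.card_fin]
    · intro w hw
      obtain ⟨j, -, rfl⟩ := Finset.mem_image.1 hw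
      exact .inl (mem_extend_edges.2 (.inl ⟨i, j, rfl, rfl⟩))
  · refine ⟨Finset.univ.image (I.inA h), Finset.subset_union_left, ?_, ?_, ?_⟩
    · simp
    · rw [Finset.card_image_of_injective _ inA_injective, Finset.card_univ, Fintype.card_fin]
    · intro w hw
      obtain ⟨j, -, rfl⟩ := Finset.mem_image.1 hw
      exact .inr (mem_extend_edges.2 (.inl ⟨j, i, rfl, rfl⟩))

theorem pathwidth_extend (hh : 0 < h) (hI : I.graph.IsPathDecomposition I.bagSets) :
    LGraph.width (I.extendBagSets h) = I.padding h ∧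
      (I.extendGraph h E v u).pathwidth = I.padding h := by
  have hP := isPathDecomposition_extend (E := E) (v := v) (u := u) (h := h) hI
  have h1 := maxBag_extend_le (I := I) (h := h)
  have h2 := padding_lt_maxBag hh hP
  have h3 : LGraph.width (I.extendBagSets h) = I.padding h := by
    unfold LGraph.width; omega
  refine ⟨h3, le_antisymm (Nat.sInf_le ⟨_, hP, h3⟩) ?_⟩
  refine le_csInf ⟨_, _, hP, rfl⟩ ?_
  rintro _ ⟨B, hB, rfl⟩
  have := padding_lt_maxBag hh hB
  unfold LGraph.width
  omega

theorem isOptimal_extend (hh : 0 < h) (hI : I.IsOptimal) : (I.extend h E v u).IsOptimal := by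
  have h1 := pathwidth_extend (E := E) (v := v) (u := u) hh hI.1
  unfold IsOptimal
  have h2 : (I.extend h E v u).bagSets = I.extendBagSets h := map_toFinset_extendBags
  rw [h2]
  exact ⟨isPathDecomposition_extend hI.1, h1.1.trans h1.2.symm⟩

/-- The truncated subtraction in the width is harmless: `maxBag ≤ width + 1` always holds. -/
theorem padding_le (hI : I.IsOptimal) : I.padding h ≤ I.graph.pathwidth + (h + 1) := by
  have := hI.2
  unfold LGraph.width at this
  unfold padding
  omega

end HomInput

/-! ### Homomorphisms to a component of a core -/

namespace LGraph

variable {V : Type*} {H : LGraph V}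

theorem Reachable.symm {x y : V} (h : H.Reachable x y) : H.Reachable y x :=
  have : Std.Symm H.Adj := ⟨H.symm⟩
  Relation.ReflTransGen.stdSymm.symm _ _ h

theorem Reachable.trans {x y z : V} (h : H.Reachable x y) (h' : H.Reachable y z) :
    H.Reachable x z :=
  Relation.ReflTransGen.trans h h'

theorem Reachable.map {W : Type*} {G : LGraph W} (f : G.Adj →r H.Adj) {x y : W}
    (h : G.Reachable x y) : H.Reachable (f x) (f y) :=
  h.lift f fun _ _ => f.map_rel

theorem reachable_component {v : V} (w : {w : V // H.Reachable v w}) :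
    (H.component v).Reachable ⟨v, .refl⟩ w := by
  obtain ⟨w, hw⟩ := w
  induction hw with
  | refl => exact .refl
  | tail h h' ih => exact ih.tail h'

/-- A component of a core has no homomorphism to the other components. -/
theorem IsCore.reachable_apply (hcore : H.IsCore) {v : V}
    (f : (H.component v).Adj →r H.Adj) (w : {w : V // H.Reachable v w}) :
    H.Reachable v (f w) := by
  classical
  suffices h : H.Reachable v (f ⟨v, .refl⟩) from h.trans ((reachable_component w).map f)
  by_contra hv
  have hf : ∀ w, ¬ H.Reachable v (f w) := fun w h =>
    hv (h.trans ((reachable_component w).map f).symm)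
  -- `K` is `H` without the component of `v`. If `f` avoided that component, then `f` there and the
  -- identity elsewhere would map `H` to the proper subgraph `K`.
  let K : H.Subgraph :=
    { verts := {w | ¬ H.Reachable v w}
      Adj := fun x y => H.Adj x y ∧ ¬ H.Reachable v x
      symm := fun x y h => ⟨H.symm x y h.1, fun h' => h.2 (h'.tail (H.symm x y h.1))⟩
      adj_sub := fun x y h => h.1
      mem_verts := fun x y h => h.2 }
  refine hcore K (.inl ⟨v, fun h => h .refl⟩)
    ⟨⟨fun w => if h : H.Reachable v w then ⟨f ⟨w, h⟩, hf _⟩ else ⟨w, h⟩, fun {x y} hxy => ?_⟩⟩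
  by_cases hx : H.Reachable v x
  · have hy : H.Reachable v y := hx.tail hxy
    simp only [hx, hy, dif_pos]
    exact ⟨f.map_rel (show (H.component v).Adj ⟨x, hx⟩ ⟨y, hy⟩ from hxy), hf _⟩
  · have hy : ¬ H.Reachable v y := fun hy => hx (hy.tail (H.symm x y hxy))
    simp only [hx, hy, dif_neg, not_false_eq_true]
    exact ⟨hxy, hx⟩

/-- An isolated vertex without a loop is a whole component, and it could be sent to a vertex of any
other component. -/
theorem IsCore.exists_adj (hcore : H.IsCore) (hdisc : H.IsDisconnected) (v : V) :
    ∃ w, H.Adj v w := by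
  by_contra! hv
  have hr : ∀ w, H.Reachable v w → w = v := fun w h => by
    rcases Relation.ReflTransGen.cases_head h with rfl | ⟨c, hc, -⟩
    · rfl
    · exact absurd hc (hv c)
  obtain ⟨w, hw⟩ : ∃ w, ¬ H.Reachable v w := by
    by_contra! h
    obtain ⟨x, y, hxy⟩ := hdisc
    exact hxy ((h x).symm.trans (h y))
  refine hw (hcore.reachable_apply ⟨fun _ => w, fun {x y} hxy => ?_⟩ ⟨v, .refl⟩)
  have : H.Adj x y := hxy
  rw [hr x x.2] at this
  exact absurd this (hv _)

/-- Homomorphisms that map the respective component of the source to the component of `v`, one for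
every vertex, can be glued. -/
theorem homTo_component_of_forall {W : Type*} {G : LGraph W} {v : V}
    (h : ∀ x, ∃ f : G.Adj →r H.Adj, H.Reachable v (f x)) : G.HomTo (H.component v) := by
  choose f hf using h
  let S : Setoid W := ⟨G.Reachable, fun _ => .refl, Reachable.symm, Reachable.trans⟩
  -- One representative per component, so that adjacent vertices use the same homomorphism.
  let r : W → W := fun x => (Quotient.mk S x).out
  have hr : ∀ x, G.Reachable (r x) x := fun x => Quotient.exact (Quotient.out_eq (Quotient.mk S x))
  refine ⟨⟨fun x => ⟨f (r x) x, (hf (r x)).trans ((hr x).map _)⟩, fun {x y} hxy => ?_⟩⟩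
  have : r x = r y := congrArg Quotient.out (Quotient.sound (s := S) (.single hxy))
  change H.Adj (f (r x) x) (f (r y) y)
  rw [← this]
  exact (f (r x)).map_rel hxy

end LGraph

/-! ### The extended instance is computed in polynomial time -/

namespace LGraph

theorem foldl_max_eq {A : Type*} (f : A → ℕ) (l : List A) (k : ℕ) :
    l.foldl (fun m a => max m (f a)) k = max k ((l.map f).foldr max 0) := by
  induction l generalizing k with
  | nil => simp
  | cons a l ih => simp [ih, max_assoc]

end LGraph

namespace HomInput

open TreeData

variable {I : HomInput} {h : ℕ}

/-- The tree of `I.padding h`, where `z` is the tree of a pair of a vertex and the instance. -/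
def paddingTree (h : ℕ) (z : TreeData) : TreeData :=
  add (ofNat h) (maxCount z.tl.hd z.tl.tl.tl)

/-- The tree of the list `I.sideA h`. -/
def sideATree (h : ℕ) (z : TreeData) : TreeData :=
  rangeOnto (add (ofNat h) z.tl.hd) (paddingTree h z) nil

/-- The tree of the list `I.sideB h`. -/
def sideBTree (h : ℕ) (z : TreeData) : TreeData :=
  rangeOnto (add (paddingTree h z) (add (ofNat h) z.tl.hd)) (paddingTree h z) nil

/-- The tree of the edges of the extended instance. -/
def edgesTree (h : ℕ) (E : List (ℕ × ℕ)) (u : ℕ) (z : TreeData) : TreeData :=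
  prodOnto (sideATree h z) (sideBTree h z)
    (cons (cons z.hd (add (ofNat u) z.tl.hd)) (pairsOnto E z.tl.hd z.tl.tl.hd))

/-- The tree of the bags of the extended instance. -/
def bagsTree (h : ℕ) (z : TreeData) : TreeData :=
  consOnto (sideATree h z) (sideBTree h z) (addRange h z.tl.hd z.tl.tl.tl)

/-- The encoding of the extended instance. -/
def extendTree (h : ℕ) (E : List (ℕ × ℕ)) (u : ℕ) (z : TreeData) : TreeData :=
  cons (add (paddingTree h z) (add (paddingTree h z) (add (ofNat h) z.tl.hd)))
    (cons (edgesTree h E u z) (bagsTree h z))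

theorem polyTime_extendTree (h : ℕ) (E : List (ℕ × ℕ)) (u : ℕ) :
    PolyTime (extendTree h E u) := by
  have hn : PolyTime fun z => z.tl.hd := .hd (.tl .id)
  have hb : PolyTime fun z => z.tl.tl.tl := .tl (.tl (.tl .id))
  have hp : PolyTime (paddingTree h) := .add (.const _) (.maxCount hn hb)
  have hA : PolyTime (sideATree h) := .rangeOnto (.add (.const _) hn) hp .nil
  have hB : PolyTime (sideBTree h) := .rangeOnto (.add hp (.add (.const _) hn)) hp .nil
  have hE : PolyTime (edgesTree h E u) := .prodOnto hA hB
    (.cons (.cons (.hd .id) (.add (.const _) hn)) (.pairsOnto E hn (.hd (.tl (.tl .id)))))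
  have hX : PolyTime (bagsTree h) := .consOnto hA hB (.addRange h hn hb)
  exact .cons (.add hp (.add hp (.add (.const _) hn))) (.cons hE hX)

theorem ofList_fin {n : ℕ} (l : List (Fin n)) :
    ofList (fun v : Fin n => ofNat v) l = ofList ofNat (l.map Fin.val) :=
  (ofList_map ofNat Fin.val l).symm

theorem ofList_ofList_fin {n : ℕ} (L : List (List (Fin n))) :
    ofList (ofList fun v : Fin n => ofNat v) L =
      ofList (ofList ofNat) (L.map fun l => l.map Fin.val) := by
  rw [ofList_map]
  congr 1
  funext l
  exact ofList_fin l

theorem ofList_fin_prod {n : ℕ} (l : List (Fin n × Fin n)) :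
    ofList (fun e : Fin n × Fin n => cons (ofNat e.1) (ofNat e.2)) l =
      ofList (fun e : ℕ × ℕ => cons (ofNat e.1) (ofNat e.2))
        (l.map (Prod.map Fin.val Fin.val)) := by
  rw [ofList_map]
  rfl

theorem maxCount_bags : maxCount (ofNat I.n) (ofList (ofList fun v : Fin I.n => ofNat v) I.bags) =
    ofNat (LGraph.maxBag I.bagSets) := by
  rw [ofList_ofList_fin, maxCount_ofNat, LGraph.foldl_max_eq]
  have : ∀ X : List (Fin I.n),
      ((Finset.range I.n).filter (· ∈ X.map Fin.val)).card = X.toFinset.card := by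
    intro X
    rw [← Finset.card_map Fin.valEmbedding]
    congr 1
    ext x
    simp only [Finset.mem_filter, Finset.mem_range, List.mem_map, Finset.mem_map,
      List.mem_toFinset, Fin.valEmbedding_apply]
    exact ⟨fun h => h.2, fun ⟨a, ha, hx⟩ => ⟨hx ▸ a.2, a, ha, hx⟩⟩
  rw [List.map_map, LGraph.maxBag, bagSets, List.map_map, Nat.zero_max]
  simp only [Function.comp_def, this]

variable (I) in
/-- The tree of a pair of a vertex and an instance. -/
def encodeWith (v : ℕ) : TreeData :=
  cons (ofNat v) I.encode

theorem paddingTree_encodeWith (v : ℕ) :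
    paddingTree h (I.encodeWith v) = ofNat (I.padding h) := by
  simp only [paddingTree, encodeWith, encode, hd_cons, tl_cons, maxCount_bags, add_ofNat, padding]

theorem sideATree_encodeWith (v : ℕ) :
    sideATree h (I.encodeWith v) = ofList (fun x => ofNat x.val) (I.sideA h) := by
  have := rangeOnto_ofNat (I.n + h) (I.padding h) []
  rw [sideATree, paddingTree_encodeWith, ofList_fin]
  simp only [encodeWith, encode, hd_cons, tl_cons, add_ofNat]
  rw [Nat.add_comm h]
  refine this.trans ?_
  rw [List.append_nil, sideA, List.map_map, ← List.map_coe_finRange_eq_range, List.map_map]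
  rfl

theorem sideBTree_encodeWith (v : ℕ) :
    sideBTree h (I.encodeWith v) = ofList (fun x => ofNat x.val) (I.sideB h) := by
  have := rangeOnto_ofNat (I.padding h + (h + I.n)) (I.padding h) []
  rw [sideBTree, paddingTree_encodeWith, ofList_fin]
  simp only [encodeWith, encode, hd_cons, tl_cons, add_ofNat]
  refine this.trans ?_
  rw [List.append_nil, sideB, List.map_map, ← List.map_coe_finRange_eq_range, List.map_map]
  congr 1
  refine List.map_congr_left fun x _ => ?_
  simp only [Function.comp_apply, val_inB]
  omega

theorem edgesTree_encodeWith (E : List (Fin h × Fin h)) (v : Fin I.n) (u : Fin h) :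
    edgesTree h (E.map (Prod.map Fin.val Fin.val)) u (I.encodeWith v) =
      ofList (fun e => cons (ofNat e.1.val) (ofNat e.2.val)) (I.extendEdges h E v u) := by
  rw [edgesTree, sideATree_encodeWith, sideBTree_encodeWith, extendEdges,
    ← prodOnto_ofList (fun x : Fin (I.extendN h) => ofNat x)]
  congr 1
  simp only [encodeWith, encode, hd_cons, tl_cons, ofList, add_ofNat, val_inG, val_inT]
  congr 1
  · rw [Nat.add_comm]
  · rw [ofList_fin_prod, pairsOnto_ofNat, ofList_fin_prod, List.map_append]
    simp [Function.comp_def, Prod.map_def, Nat.add_comm]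

theorem bagsTree_encodeWith (v : ℕ) :
    bagsTree h (I.encodeWith v) = ofList (ofList fun x => ofNat x.val) (I.extendBags h) := by
  rw [bagsTree, sideATree_encodeWith, sideBTree_encodeWith, extendBags, ← consOnto_ofList]
  congr 1
  simp only [encodeWith, encode, hd_cons, tl_cons]
  rw [ofList_ofList_fin, addRange_ofNat, ofList_ofList_fin, foldl_cons_eq, foldl_cons_eq]
  congr 1
  rw [List.append_nil, List.append_nil, List.map_reverse, List.map_map, List.map_map]
  congr 1
  refine List.map_congr_left fun X _ => ?_
  simp only [Function.comp_apply, extendBag, List.map_append, List.map_map]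
  rw [← List.map_coe_finRange_eq_range, List.map_map]
  rfl

/-- The program must produce the encoding literally, list order included. This is why `extendEdges`
and `extendBags` are written as the folds that the program performs. -/
theorem extendTree_encodeWith (E : List (Fin h × Fin h)) (v : Fin I.n) (u : Fin h) :
    extendTree h (E.map (Prod.map Fin.val Fin.val)) u (I.encodeWith v) =
      (I.extend h E v u).encode := by
  rw [extendTree, paddingTree_encodeWith, edgesTree_encodeWith, bagsTree_encodeWith]
  simp only [encodeWith, encode, hd_cons, tl_cons, add_ofNat]
  congr 1
  congr 1
  change _ = I.extendN h
  unfold extendN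
  omega

theorem size_ofNat (n : ℕ) : (ofNat n).size = 2 * n + 1 := by
  induction n with
  | zero => rfl
  | succ n ih => simp only [ofNat, size, ih]; omega

theorem two_mul_n_lt_size : 2 * I.n + 1 < I.encode.size := by
  rw [encode, size, size_ofNat]
  omega

theorem size_encodeWith_le (v : Fin I.n) : (I.encodeWith v).size ≤ 3 * I.encode.size := by
  have := two_mul_n_lt_size (I := I)
  have := v.2
  rw [encodeWith, size, size_ofNat]
  omega

/-! ### Homomorphisms from the extended instance -/

/-- Testing every `v` separately covers all components of a possibly disconnected instance without
computing them; the edge to `u` pins the component of `v` to that of `w`. -/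
theorem homTo_component_iff {V : Type*} {H : LGraph V} (hcore : H.IsCore)
    (hdisc : H.IsDisconnected) {w : V} (e : {x // H.Reachable w x} ≃ Fin h)
    {E : List (Fin h × Fin h)}
    (hE : ∀ i j, (i, j) ∈ E ↔ (H.component w).Adj (e.symm i) (e.symm j)) :
    I.graph.HomTo (H.component w) ↔
      ∀ v, ∃ u, (I.extend h E v u).graph.HomTo H := by
  constructor
  · rintro ⟨f⟩ v
    -- The two sides of the bipartite graph go to the ends of the edge `wb`.
    obtain ⟨b, hb⟩ := hcore.exists_adj hdisc w
    obtain ⟨u, hu⟩ := hcore.exists_adj hdisc (f v)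
    have hu' : H.Reachable w u := (f v).2.tail hu
    let F : Fin (I.extendN h) → V :=
      extendFun (fun x => (f x).1) (fun j => (e.symm j).1) w b
    refine ⟨e ⟨u, hu'⟩, ⟨⟨F, ?_⟩⟩⟩
    suffices key : ∀ x y, (x, y) ∈ I.extendEdges h E v (e ⟨u, hu'⟩) → H.Adj (F x) (F y) by
      rintro x y (hxy | hxy)
      · exact key x y hxy
      · exact H.symm _ _ (key y x hxy)
    intro x y hxy
    rcases mem_extend_edges.1 hxy with ⟨i, j, rfl, rfl⟩ | ⟨rfl, rfl⟩ | ⟨i, j, hij, rfl, rfl⟩ |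
      ⟨i, j, hij, rfl, rfl⟩
    · simpa [F] using hb
    · simpa [F] using hu
    · simp only [F, extendFun_inT]
      exact (hE i j).1 hij
    · simp only [F, extendFun_inG]
      exact f.map_rel (show I.graph.Adj i j from .inl hij)
  · intro hv
    refine LGraph.homTo_component_of_forall fun v => ?_
    obtain ⟨u, ⟨f⟩⟩ := hv v
    have hf : ∀ x y, (x, y) ∈ I.extendEdges h E v u → H.Adj (f x) (f y) :=
      fun x y hxy => f.map_rel (.inl hxy)
    let g : (H.component w).Adj →r H.Adj := ⟨fun x => f (I.inT h (e x)), fun {x y} hxy =>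
      hf _ _ (mem_extend_edges.2 (.inr (.inr (.inl
        ⟨e x, e y, (hE _ _).2 (by simpa using hxy), rfl, rfl⟩))))⟩
    -- The copy may be mapped to its component in any way; only the component of the image of `u`
    -- matters.
    have hg := hcore.reachable_apply g (e.symm u)
    refine ⟨⟨fun x => f (I.inG h x), fun {x y} hxy => ?_⟩, ?_⟩
    · have key : ∀ x y, (x, y) ∈ I.edges → H.Adj (f (I.inG h x)) (f (I.inG h y)) :=
        fun x y hxy => hf _ _ (mem_extend_edges.2 (.inr (.inr (.inr ⟨x, y, hxy, rfl, rfl⟩))))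
      rcases hxy with hxy | hxy
      · exact key x y hxy
      · exact H.symm _ _ (key y x hxy)
    · have h1 : H.Adj (f (I.inG h v)) (f (I.inT h u)) :=
        hf _ _ (mem_extend_edges.2 (.inr (.inl ⟨rfl, rfl⟩)))
      have h2 : g (e.symm u) = f (I.inT h u) := by
        change f (I.inT h (e (e.symm u))) = _
        rw [e.apply_symm_apply]
      rw [h2] at hg
      exact hg.tail (H.symm _ _ h1)

end HomInput

/-! ### Programs that combine calls of a program -/

/-- On input `x`, the program halts within time `T`, and its output is not empty if and only if `P`
holds. -/
def TreeProg.Decides (p : TreeProg) (x : TreeData) (T : ℝ) (P : Prop) : Prop :=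
  ∃ (y : TreeData) (t : ℕ), p.Run x y t ∧ (t : ℝ) ≤ T ∧ (y ≠ .nil ↔ P)

namespace TreeProg

/-- The input `x` itself serves as the positive answer, hence the assumption that it is not empty.
-/
theorem Decides.or {p q r : TreeProg} {x y : TreeData} {s : ℕ} {T T' : ℝ} {P Q : Prop}
    (hq : q.Run x y s) (hp : p.Decides y T P) (hr : r.Decides x T' Q) (hx : x ≠ .nil)
    (hT' : 0 ≤ T') :
    (TreeProg.ifElse (.seq q p) .id r).Decides x (s + T + T' + 3) (P ∨ Q) := by
  obtain ⟨b, t, hb, ht, hP⟩ := hp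
  obtain ⟨z, t', hz, ht', hQ⟩ := hr
  by_cases h : b = .nil
  · subst h
    refine ⟨z, _, .ifFalse (.seq hq hb) hz, by push_cast; linarith, ?_⟩
    simp_all
  · refine ⟨x, _, .ifTrue (.seq hq hb) h (.id x), by push_cast; linarith, ?_⟩
    simp_all

/-- The body of the loop of `forallLt`. -/
def forallLtBody (p : TreeProg) : TreeProg :=
  .ifElse (.seq (.pair (.seq .hd .tl) .tl) p) (.pair (.seq .hd .tl) .tl) .nil

/-- On an input whose left child is the number `n`, test `p` for all numbers less than `n`. -/
def forallLt (p : TreeProg) : TreeProg :=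
  .seq (.pair .hd .id) (.seq (.loop .hd (forallLtBody p)) .tl)

/-- The state is a counter paired with `x`. A failed test replaces it by `nil`, which both stops the
loop and has an empty tail; if all tests succeed, the tail is still `x`. -/
theorem run_loop_forallLtBody {p : TreeProg} {x : TreeData} {T : ℝ} {P : ℕ → Prop} (n : ℕ)
    (hT : 0 ≤ T) (hx : x ≠ .nil) (hp : ∀ k < n, p.Decides (.cons (.ofNat k) x) T (P k)) :
    ∃ (y : TreeData) (t : ℕ),
      (TreeProg.loop .hd (forallLtBody p)).Run (.cons (.ofNat n) x) y t ∧
      (t : ℝ) ≤ n * (T + 20) + 2 ∧ (y.tl ≠ .nil ↔ ∀ k < n, P k) := by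
  induction n with
  | zero => exact ⟨_, _, .loopStop (.hd _), by norm_num, by simpa [TreeData.tl] using hx⟩
  | succ n ih =>
    obtain ⟨b, t, hb, ht, hP⟩ := hp n (by omega)
    have hpair : (TreeProg.pair (.seq .hd .tl) .tl).Run (.cons (.ofNat (n + 1)) x)
        (.cons (.ofNat n) x) _ := .pair (.seq (.hd _) (.tl _)) (.tl _)
    have hn : (TreeData.cons (.ofNat (n + 1)) x).hd ≠ .nil := by
      simp [TreeData.hd, TreeData.ofNat]
    by_cases h : b = .nil
    · subst h
      refine ⟨.nil, _, .loopStep (.hd _) hn (.ifFalse (.seq hpair hb) (.nil _))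
        (.loopStop (.hd _)), ?_, ?_⟩
      · push_cast
        nlinarith
      · have : ¬ P n := by simpa using hP
        simp only [TreeData.tl, ne_eq, not_true_eq_false, false_iff, not_forall]
        exact ⟨n, by omega, this⟩
    · obtain ⟨y, t', hy, ht', hiff⟩ := ih fun k hk => hp k (by omega)
      refine ⟨y, _, .loopStep (.hd _) hn (.ifTrue (.seq hpair hb) h hpair) hy, ?_, ?_⟩
      · push_cast
        linarith
      · rw [hiff]
        have : P n := hP.1 h
        exact ⟨fun H k hk => (Nat.lt_succ_iff_lt_or_eq.1 hk).elim (H k) fun e => e ▸ this,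
          fun H k hk => H k (by omega)⟩

theorem decides_forallLt {p : TreeProg} {x : TreeData} {T : ℝ} {P : ℕ → Prop} {n : ℕ}
    (hT : 0 ≤ T) (hx : x.hd = .ofNat n) (hx' : x ≠ .nil)
    (hp : ∀ k < n, p.Decides (.cons (.ofNat k) x) T (P k)) :
    (forallLt p).Decides x (n * (T + 20) + 8) (∀ k < n, P k) := by
  obtain ⟨y, t, hy, ht, hiff⟩ := run_loop_forallLtBody n hT hx' hp
  have h1 := Run.hd x
  rw [hx] at h1
  exact ⟨_, _, .seq (.pair h1 (.id x)) (.seq hy (.tl y)), by push_cast; linarith, hiff⟩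

end TreeProg

/-! ### The reduction -/

theorem exists_decides_extend {V : Type*} {H : LGraph V} {α : ℝ} (hα : 1 ≤ α)
    (hH : HomSolvableInTime H α) {h : ℕ} (hh : 0 < h) (E : List (Fin h × Fin h))
    (us : List (Fin h)) :
    ∃ (p : TreeProg) (Q : ℕ[X]), ∀ I : HomInput, I.IsOptimal → ∀ v : Fin I.n,
      p.Decides (I.encodeWith v) (α ^ I.graph.pathwidth * (Q.eval I.encode.size : ℕ))
        (∃ u ∈ us, (I.extend h E v u).graph.HomTo H) := by
  induction us with
  | nil =>
    refine ⟨.nil, 1, fun I _ v => ⟨_, _, .nil _, ?_, by simp⟩⟩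
    simpa using one_le_pow₀ hα
  | cons u us ih =>
    obtain ⟨r, R, hr⟩ := ih
    obtain ⟨p, c, d, hp⟩ := hH
    obtain ⟨q, P, hq⟩ := HomInput.polyTime_extendTree h (E.map (Prod.map Fin.val Fin.val)) u
    -- The excess `h + 1` of the pathwidth costs a constant factor, rounded up to fit into a
    -- polynomial over `ℕ`.
    obtain ⟨M, hM⟩ := exists_nat_ge (α ^ (h + 1))
    refine ⟨.ifElse (.seq q p) .id r,
      P.comp (3 * X) + (C (c * M) * P.comp (3 * X) ^ d + R + 3), fun I hI v => ?_⟩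
    obtain ⟨hsize, s, hs, hrun⟩ := hq (I.encodeWith v)
    rw [HomInput.extendTree_encodeWith] at hsize hrun
    have hmono := P.eval_nat_mono (HomInput.size_encodeWith_le v)
    have hdec : p.Decides (I.extend h E v u).encode _ _ :=
      hp _ (HomInput.isOptimal_extend (E := E) (v := v) (u := u) hh hI)
    have hA : 1 ≤ α ^ I.graph.pathwidth := one_le_pow₀ hα
    have hor := TreeProg.Decides.or hrun hdec (hr I hI v) (by simp [HomInput.encodeWith])
      (by positivity)
    obtain ⟨y, t, hy, ht, hiff⟩ := hor
    refine ⟨y, t, hy, ht.trans ?_, by rw [hiff]; simp⟩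
    have hpw : (I.extend h E v u).graph.pathwidth = I.padding h :=
      (HomInput.pathwidth_extend (E := E) (v := v) (u := u) hh hI.1).2
    rw [hpw]
    set A := α ^ I.graph.pathwidth with hAdef
    set B := P.eval (3 * I.encode.size) with hB
    have h1 : α ^ I.padding h ≤ A * M := by
      refine (pow_le_pow_right₀ hα (HomInput.padding_le hI)).trans ?_
      rw [pow_add]
      gcongr
    have h2 : ((I.extend h E v u).encode.size : ℝ) ≤ B := by
      exact_mod_cast hsize.trans hmono
    have h3 : (s : ℝ) ≤ B := by
      exact_mod_cast hs.trans hmono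
    have h4 : (c : ℝ) * α ^ I.padding h * ((I.extend h E v u).encode.size : ℝ) ^ d ≤
        c * (A * M) * (B : ℝ) ^ d := by
      gcongr
    have h5 : (B : ℝ) ≤ A * B := le_mul_of_one_le_left (by positivity) hA
    have h6 : ((P.comp (3 * X) + (C (c * M) * P.comp (3 * X) ^ d + R + 3)).eval
        I.encode.size : ℕ) = B + (c * M * B ^ d + R.eval I.encode.size + 3) := by
      simp [hB]
    rw [h6]
    push_cast
    linarith

theorem mainTheorem11 {V : Type*} [Finite V] (H : LGraph V)
    (hcore : H.IsCore) (hdisc : H.IsDisconnected)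
    (α : ℝ) (hα : 1 ≤ α) (hH : HomSolvableInTime H α) :
    ∀ v : V, HomSolvableInTime (H.component v) α := by
  classical
  intro w
  obtain ⟨h, ⟨e⟩⟩ := Finite.exists_equiv_fin {x // H.Reachable w x}
  have hh : 0 < h := Fin.pos (e ⟨w, .refl⟩)
  let E : List (Fin h × Fin h) := (Finset.univ.filter fun i : Fin h × Fin h =>
    (H.component w).Adj (e.symm i.1) (e.symm i.2)).toList
  have hE : ∀ i j, (i, j) ∈ E ↔ (H.component w).Adj (e.symm i) (e.symm j) := by
    simp [E]
  obtain ⟨p, Q, hp⟩ := exists_decides_extend hα hH hh E (List.finRange h)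
  let R : ℕ[X] := X * (Q + 20) + 8
  refine ⟨p.forallLt, R.eval 1, R.natDegree, fun I hI => ?_⟩
  have hA : 1 ≤ α ^ I.graph.pathwidth := one_le_pow₀ hα
  set A := α ^ I.graph.pathwidth with hAdef
  obtain ⟨y, t, hy, ht, hiff⟩ := TreeProg.decides_forallLt (p := p) (x := I.encode) (n := I.n)
    (T := A * (Q.eval I.encode.size : ℕ))
    -- The loop counts natural numbers, so the bound `k < I.n` is packed into the predicate.
    (P := fun k => ∃ hk : k < I.n, ∃ u ∈ List.finRange h,
      (I.extend h E ⟨k, hk⟩ u).graph.HomTo H)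
    (by positivity) rfl (by simp [HomInput.encode]) fun k hk => by
      simp only [hk, exists_true_left]
      exact hp I hI ⟨k, hk⟩
  refine ⟨y, t, hy, ht.trans ?_, hiff.trans ?_⟩
  · have h1 : (I.n : ℝ) ≤ I.encode.size := by
      have := HomInput.two_mul_n_lt_size (I := I)
      exact_mod_cast (by omega : I.n ≤ I.encode.size)
    have h2 : ((R.eval I.encode.size : ℕ) : ℝ) ≤
        (R.eval 1 : ℕ) * (I.encode.size : ℝ) ^ R.natDegree := by
      exact_mod_cast R.eval_nat_le (TreeData.one_le_size _)
    have h3 : R.eval I.encode.size = I.encode.size * (Q.eval I.encode.size + 20) + 8 := by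
      simp [R]
    rw [h3] at h2
    push_cast at h2
    -- Since `1 ≤ A`, the additive overheads can be multiplied by `A`, which then factors out.
    calc (I.n : ℝ) * (A * (Q.eval I.encode.size : ℕ) + 20) + 8
        ≤ I.encode.size * (A * (Q.eval I.encode.size : ℕ) + A * 20) + A * 8 := by
          gcongr <;> linarith
      _ = A * (I.encode.size * ((Q.eval I.encode.size : ℕ) + 20) + 8) := by ring
      _ ≤ A * ((R.eval 1 : ℕ) * (I.encode.size : ℝ) ^ R.natDegree) := by gcongr
      _ = _ := by ring
  · rw [HomInput.homTo_component_iff hcore hdisc e hE]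
    simp only [List.mem_finRange, true_and]
    exact ⟨fun H v => (H v v.2).2, fun H k hk => ⟨hk, H ⟨k, hk⟩⟩⟩
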